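/- Let $V$ be a complex vector space of finite dimension $n$, let $S^2(V)\subset V\otimes V$ be the space of symmetric forms (in a basis of $V$: symmetric $n\times n$ matrices $Q$), and let $\rho$ be the representation of $\mathrm{gl}(V)$ on $S^2(V)$ corresponding to the congruence action $Q\mapsto PQP^T$ of $\mathrm{GL}(V)$, i.e. $\rho(X)=X\otimes 1+1\otimes X$, in a basis $\rho(X)Q=XQ+QX^T$. For $x\in S^2(V)$ put $R_x:\mathrm{gl}(V)\to S^2(V)$, $R_x(\xi)=\rho(\xi)x$. By the Jordan--Kronecker theorem, for every pair of linear maps $A,B:U\to W$ of finite-dimensional complex vector spaces there are bases of $U$ and $W$ in which $A+\lambda B$ is block-diagonal with blocks of the following kinds: $k\times k$ Jordan blocks with eigenvalue $\mu\in\mathbb C$ ($A_i=\mu I+N$, $B_i=I$, where $N$ has ones on the superdiagonal and zeros elsewhere) or with eigenvalue $\infty$ ($A_i=I$, $B_i=N$); horizontal Kronecker blocks of size $(h-1)\times h$, $h\ge 1$ ($A_i=(0\mid I_{h-1})$, $B_i=(I_{h-1}\mid 0)$); and vertical Kronecker blocks of size $v\times(v-1)$, $v\ge 1$ (transposes of horizontal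 ones). The numbers $h$ and $v$ are called the horizontal and vertical indices. The algebraic type of the pencil consists of the number of distinct eigenvalues, the sizes of the Jordan blocks belonging to each of them, and the multisets of horizontal and vertical indices. The Jordan--Kronecker invariants of $\rho$ are the algebraic type of $R_a+\lambda R_b$ for a generic pair $(a,b)$, i.e. for all pairs in some nonempty Zariski open subset of $S^2(V)\times S^2(V)$. **Theorem.** The Jordan--Kronecker invariants of $\rho$ are: $n$ Jordan blocks of size $1\times 1$ with pairwise distinct eigenvalues, and $\frac{n(n-1)}{2}$ horizontal indices, all equal to $2$ (and there are no vertical indices). -/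

import Mathlib

open scoped TensorProduct

-- `Module.End ℂ W` is the Lie algebra `gl(W)`, with the commutator as bracket.
attribute [local instance] LieRing.ofAssociativeRing

/-! ### Jordan–Kronecker normal form of a pair of linear maps -/

/-- The four kinds of blocks of the Jordan–Kronecker normal form. A horizontal block is labelled by
its width `h` and has `h - 1` rows; a vertical block is labelled by its height `v` and has `v - 1`
columns. In particular `horizontal 1` is the `0 × 1` block and `vertical 1` is the `1 × 0` block,
so that zero rows and columns of a pencil are covered. -/
inductive JKBlock where
  | jordan (μ : ℂ) (k : ℕ+)
  | jordanInfty (k : ℕ+)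
  | horizontal (h : ℕ+)
  | vertical (v : ℕ+)

namespace JKBlock

/-- The number of rows of a block. -/
def rows : JKBlock → ℕ
  | jordan _ k => k
  | jordanInfty k => k
  | horizontal h => h - 1
  | vertical v => v

/-- The number of columns of a block. -/
def cols : JKBlock → ℕ
  | jordan _ k => k
  | jordanInfty k => k
  | horizontal h => h
  | vertical v => v - 1

/-- The matrix `A_i` of a block `A_i + λ B_i`. -/
noncomputable def matA : (β : JKBlock) → Matrix (Fin β.rows) (Fin β.cols) ℂ
  | jordan μ _ => Matrix.of fun i j =>
      if (j : ℕ) = i then μ else if (j : ℕ) = i + 1 then 1 else 0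
  | jordanInfty _ => Matrix.of fun i j => if (j : ℕ) = i then 1 else 0
  | horizontal _ => Matrix.of fun i j => if (j : ℕ) = i + 1 then 1 else 0
  | vertical _ => Matrix.of fun i j => if (i : ℕ) = j + 1 then 1 else 0

/-- The matrix `B_i` of a block `A_i + λ B_i`. -/
noncomputable def matB : (β : JKBlock) → Matrix (Fin β.rows) (Fin β.cols) ℂ
  | jordan _ _ => Matrix.of fun i j => if (j : ℕ) = i then 1 else 0
  | jordanInfty _ => Matrix.of fun i j => if (j : ℕ) = i + 1 then 1 else 0
  | horizontal _ => Matrix.of fun i j => if (j : ℕ) = i then 1 else 0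
  | vertical _ => Matrix.of fun i j => if (i : ℕ) = j then 1 else 0

/-- The eigenvalue (in `ℂ ∪ {∞}`) and the size of a Jordan block. -/
def jordanData : JKBlock → Option (OnePoint ℂ × ℕ+)
  | jordan μ k => some ((μ : OnePoint ℂ), k)
  | jordanInfty k => some (OnePoint.infty, k)
  | _ => none

/-- The horizontal index (width) of a horizontal Kronecker block. -/
def horizontalIndex : JKBlock → Option ℕ+
  | horizontal h => some h
  | _ => none

/-- The vertical index (height) of a vertical Kronecker block. -/
def verticalIndex : JKBlock → Option ℕ+
  | vertical v => some v
  | _ => none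

end JKBlock

/-- The pencil `A + λ B` has, in suitable bases of `U` and `W`, the block-diagonal form whose
diagonal blocks are the blocks of the family `blk`. -/
def HasJKNormalForm {U W : Type*} [AddCommGroup U] [Module ℂ U] [AddCommGroup W] [Module ℂ W]
    (A B : U →ₗ[ℂ] W) {ι : Type} [Fintype ι] [DecidableEq ι] (blk : ι → JKBlock) : Prop :=
  ∃ (bU : Module.Basis (Σ i, Fin (blk i).cols) ℂ U)
    (bW : Module.Basis (Σ i, Fin (blk i).rows) ℂ W),
    LinearMap.toMatrix bU bW A = Matrix.blockDiagonal' (fun i => (blk i).matA) ∧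
    LinearMap.toMatrix bU bW B = Matrix.blockDiagonal' (fun i => (blk i).matB)

/-- The discrete invariants of a pencil. The multiset `jordan` has one member for each distinct
eigenvalue, namely the multiset of the sizes of the Jordan blocks with that eigenvalue (so its
cardinality is the number of distinct eigenvalues); `horizontal` and `vertical` are the multisets
of horizontal and vertical Kronecker indices. -/
@[ext]
structure AlgebraicType where
  jordan : Multiset (Multiset ℕ+)
  horizontal : Multiset ℕ+
  vertical : Multiset ℕ+

open Classical in
/-- The discrete invariants read off from a multiset of Jordan–Kronecker blocks. -/
noncomputable def AlgebraicType.ofBlocks (s : Multiset JKBlock) : AlgebraicType where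
  jordan := ((s.filterMap JKBlock.jordanData).map Prod.fst).dedup.map fun μ =>
    ((s.filterMap JKBlock.jordanData).filter fun q => q.1 = μ).map Prod.snd
  horizontal := s.filterMap JKBlock.horizontalIndex
  vertical := s.filterMap JKBlock.verticalIndex

/-- The pencil `A + λ B` has algebraic type `T`. -/
def HasAlgebraicType {U W : Type*} [AddCommGroup U] [Module ℂ U] [AddCommGroup W] [Module ℂ W]
    (A B : U →ₗ[ℂ] W) (T : AlgebraicType) : Prop :=
  ∃ (ι : Type) (_ : Fintype ι) (_ : DecidableEq ι) (blk : ι → JKBlock),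
    HasJKNormalForm A B blk ∧ AlgebraicType.ofBlocks (Finset.univ.val.map blk) = T

/-! ### Jordan–Kronecker invariants of a representation -/

/-- `P x` holds for generic `x` in the finite-dimensional complex vector space `E`: it holds
outside the zero locus of some nonzero polynomial function, that is, on a nonempty Zariski open
set. (The choice of the linear coordinates is immaterial.) -/
def HoldsGenerically {E : Type*} [AddCommGroup E] [Module ℂ E] (P : E → Prop) : Prop :=
  ∃ (b : Module.Basis (Fin (Module.finrank ℂ E)) ℂ E)
    (p : MvPolynomial (Fin (Module.finrank ℂ E)) ℂ),
    p ≠ 0 ∧ ∀ x : E, MvPolynomial.eval (fun i => b.repr x i) p ≠ 0 → P x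

/-- The operator `R_x : 𝔤 → W`, `R_x ξ = ρ(ξ) x`. -/
def orbitMap {𝔤 W : Type*} [LieRing 𝔤] [LieAlgebra ℂ 𝔤] [AddCommGroup W] [Module ℂ W]
    (ρ : 𝔤 →ₗ⁅ℂ⁆ Module.End ℂ W) (x : W) : 𝔤 →ₗ[ℂ] W where
  toFun ξ := ρ ξ x
  map_add' ξ η := by simp
  map_smul' c ξ := by simp

/-- The Jordan–Kronecker invariants of `ρ` are given by `T`: for a generic pair `(a, b)` of vectors
the pencil `R_a + λ R_b` has algebraic type `T`. -/
def HasJKInvariants {𝔤 W : Type*} [LieRing 𝔤] [LieAlgebra ℂ 𝔤] [AddCommGroup W] [Module ℂ W]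
    (ρ : 𝔤 →ₗ⁅ℂ⁆ Module.End ℂ W) (T : AlgebraicType) : Prop :=
  HoldsGenerically fun x : W × W => HasAlgebraicType (orbitMap ρ x.1) (orbitMap ρ x.2) T

/-! ### The congruence representation on symmetric forms -/

section Congruence

variable (V : Type*) [AddCommGroup V] [Module ℂ V]

/-- `S²(V)`, the space of symmetric elements of `V ⊗ V`. -/
def SymForms : Submodule ℂ (V ⊗[ℂ] V) :=
  LinearMap.eqLocus (TensorProduct.comm ℂ V V).toLinearMap LinearMap.id

variable {V}

/-- The differential `X ⊗ 1 + 1 ⊗ X` of the congruence action `P ↦ P ⊗ P` of `GL(V)` on `V ⊗ V`.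
In coordinates it is `Q ↦ X Q + Q Xᵀ`, see `tensorMatrix_congruence`. -/
noncomputable def congruenceOp (X : Module.End ℂ V) : Module.End ℂ (V ⊗[ℂ] V) :=
  TensorProduct.map X LinearMap.id + TensorProduct.map LinearMap.id X

theorem comm_congruenceOp (X : Module.End ℂ V) (Q : V ⊗[ℂ] V) :
    TensorProduct.comm ℂ V V (congruenceOp X Q) = congruenceOp X (TensorProduct.comm ℂ V V Q) := by
  induction Q using TensorProduct.induction_on with
  | zero => simp
  | tmul x y => simp [congruenceOp, add_comm]
  | add x y hx hy => simp only [map_add, hx, hy]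

theorem congruenceOp_mem (X : Module.End ℂ V) (Q : V ⊗[ℂ] V) (hQ : Q ∈ SymForms V) :
    congruenceOp X Q ∈ SymForms V := by
  have h : TensorProduct.comm ℂ V V Q = Q := hQ
  change TensorProduct.comm ℂ V V (congruenceOp X Q) = congruenceOp X Q
  rw [comm_congruenceOp, h]

theorem congruenceOp_lie (X Y : Module.End ℂ V) (Q : V ⊗[ℂ] V) :
    congruenceOp ⁅X, Y⁆ Q =
      congruenceOp X (congruenceOp Y Q) - congruenceOp Y (congruenceOp X Q) := by
  induction Q using TensorProduct.induction_on with
  | zero => simp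
  | tmul x y =>
    simp [congruenceOp, Ring.lie_def, TensorProduct.sub_tmul, TensorProduct.tmul_sub]
    abel
  | add x y hx hy => simp only [map_add, hx, hy]; abel

variable (V) in
/-- The representation of `gl(V)` on the symmetric forms `S²(V)` corresponding to the congruence
action. -/
noncomputable def congruenceRep : Module.End ℂ V →ₗ⁅ℂ⁆ Module.End ℂ (SymForms V) where
  toFun X := (congruenceOp X).restrict (congruenceOp_mem X)
  map_add' X Y := by
    ext Q
    simp [congruenceOp, TensorProduct.map_add_left, TensorProduct.map_add_right]
    abel
  map_smul' c X := by
    ext Q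
    simp [congruenceOp, TensorProduct.map_smul_left, TensorProduct.map_smul_right]
  map_lie' {X Y} := by
    ext Q
    simpa [Ring.lie_def] using congruenceOp_lie X Y (Q : V ⊗[ℂ] V)

/-- The matrix `(Q_{ij})` of `Q = ∑ Q_{ij} e_i ⊗ e_j`. -/
noncomputable def tensorMatrix {ι : Type*} (b : Module.Basis ι ℂ V) (Q : V ⊗[ℂ] V) :
    Matrix ι ι ℂ :=
  Matrix.of fun i j => (b.tensorProduct b).repr Q (i, j)

/-- The elements of `S²(V)` are those with a symmetric matrix. -/
theorem mem_symForms_iff {ι : Type*} (b : Module.Basis ι ℂ V) (Q : V ⊗[ℂ] V) :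
    Q ∈ SymForms V ↔ (tensorMatrix b Q).IsSymm := by
  have key : tensorMatrix b (TensorProduct.comm ℂ V V Q) = (tensorMatrix b Q).transpose := by
    induction Q using TensorProduct.induction_on with
    | zero => ext; simp [tensorMatrix]
    | tmul x y => ext; simp [tensorMatrix, mul_comm]
    | add x y hx hy =>
      ext i j
      have h1 := congrFun (congrFun hx i) j
      have h2 := congrFun (congrFun hy i) j
      simp only [tensorMatrix, Matrix.of_apply, Matrix.transpose_apply] at h1 h2
      simp [tensorMatrix, h1, h2]
  have inj : Function.Injective (tensorMatrix b) := fun Q Q' h => by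
    apply (b.tensorProduct b).repr.injective
    ext ⟨i, j⟩
    exact congrFun (congrFun h i) j
  rw [Matrix.IsSymm, ← key]
  exact inj.eq_iff.symm

/-- In coordinates the congruence action `P ⊗ P` is `Q ↦ P Q Pᵀ`. -/
theorem tensorMatrix_map {ι : Type*} [Fintype ι] [DecidableEq ι] (b : Module.Basis ι ℂ V)
    (P P' : Module.End ℂ V) (Q : V ⊗[ℂ] V) :
    tensorMatrix b (TensorProduct.map P P' Q) =
      LinearMap.toMatrix b b P * tensorMatrix b Q * (LinearMap.toMatrix b b P').transpose := by
  induction Q using TensorProduct.induction_on with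
  | zero => 
    have : tensorMatrix b (0 : V ⊗[ℂ] V) = 0 := by ext; simp [tensorMatrix]
    simp [this]
  | tmul x y =>
    have hv : ∀ u v : V, tensorMatrix b (u ⊗ₜ[ℂ] v) = Matrix.vecMulVec (b.repr u) (b.repr v) := by
      intro u v
      ext i j
      simp [tensorMatrix, Matrix.vecMulVec_apply, mul_comm]
    rw [TensorProduct.map_tmul, hv, hv, Matrix.mul_vecMulVec, Matrix.vecMulVec_mul,
      Matrix.vecMul_transpose, LinearMap.toMatrix_mulVec_repr, LinearMap.toMatrix_mulVec_repr]
  | add x y hx hy =>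
    have ha : ∀ u v : V ⊗[ℂ] V, tensorMatrix b (u + v) = tensorMatrix b u + tensorMatrix b v := by
      intro u v
      ext i j
      simp [tensorMatrix]
    rw [map_add, ha, ha, hx, hy, mul_add, add_mul]

/-- In coordinates the representation is `Q ↦ X Q + Q Xᵀ`. -/
theorem tensorMatrix_congruence {ι : Type*} [Fintype ι] [DecidableEq ι] (b : Module.Basis ι ℂ V)
    (X : Module.End ℂ V) (Q : SymForms V) :
    tensorMatrix b (congruenceRep V X Q : V ⊗[ℂ] V) =
      LinearMap.toMatrix b b X * tensorMatrix b (Q : V ⊗[ℂ] V) +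
        tensorMatrix b (Q : V ⊗[ℂ] V) * (LinearMap.toMatrix b b X).transpose := by
  have ha : ∀ u v : V ⊗[ℂ] V, tensorMatrix b (u + v) = tensorMatrix b u + tensorMatrix b v := by
    intro u v
    ext i j
    simp [tensorMatrix]
  change tensorMatrix b (TensorProduct.map X LinearMap.id (Q : V ⊗[ℂ] V) +
    TensorProduct.map LinearMap.id X (Q : V ⊗[ℂ] V)) = _
  rw [ha, tensorMatrix_map, tensorMatrix_map]
  simp

end Congruence

/-! ### A polynomial condition for simultaneous diagonalisability by congruence -/

section Matrices

open Matrix Polynomial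

/-! If `b` is nondegenerate and the pencil of `a` and `b` has `n` distinct eigenvalues, then some
basis `e` gives `a = ∑ μ_i e_i ⊗ e_i` and `b = ∑ e_i ⊗ e_i` with distinct `μ_i`
(`exists_simultaneous_congruence`, `exists_basis_eq_diagForm`). Write `E_ij` for the matrix units
and `s_ij = e_i ⊗ e_j + e_j ⊗ e_i`. Then `R_a E_ij = μ_j s_ij` and `R_b E_ij = s_ij`
(`orbitMap_elemOp`), so the pencil splits. Each `E_ii` gives a `1 × 1` Jordan block with eigenvalue
`μ_i`. For `i < j` the plane of `E_ij, E_ji` maps to the line of `s_ij` by the rows `(μ_j, μ_i)` and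
`(1, 1)`. These are independent because `μ_i ≠ μ_j`, so a change of basis of the plane turns them
into `(0, 1)` and `(1, 0)`, a horizontal block of width 2.

The condition on `(a, b)` is the nonvanishing of `pencilGenericity`. The adjugate replaces the
inverse of `B` to keep it polynomial, which only rescales the eigenvalues by `det B`; the polynomial
is nonzero because it is nonzero at one diagonal pair. -/

/-- A polynomial in the entries of `A` and `B` whose nonvanishing says that `B` is invertible and
that `A * B⁻¹` has pairwise distinct eigenvalues. -/
noncomputable def pencilGenericity {n R : Type*} [Fintype n] [DecidableEq n] [CommRing R]
    (A B : Matrix n n R) : R :=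
  B.det * (aeval (A * B.adjugate) (derivative (A * B.adjugate).charpoly)).det

/-- Lets the quantity be formed over a polynomial ring and then evaluated at a point. -/
theorem map_pencilGenericity {n R S : Type*} [Fintype n] [DecidableEq n] [CommRing R] [CommRing S]
    (f : R →+* S) (A B : Matrix n n R) :
    f (pencilGenericity A B) = pencilGenericity (f.mapMatrix A) (f.mapMatrix B) := by
  have h : ∀ (M : Matrix n n R) (p : R[X]),
      f.mapMatrix (aeval M p) = aeval (f.mapMatrix M) (p.map f) := by
    intro M p
    induction p using Polynomial.induction_on' with
    | add p q hp hq => simp only [map_add, hp, hq, Polynomial.map_add]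
    | monomial k c =>
      simp only [Polynomial.map_monomial, aeval_monomial, map_mul, map_pow]
      congr 1
      ext i j
      simp [Matrix.algebraMap_matrix_apply, apply_ite f]
  rw [pencilGenericity, pencilGenericity, map_mul, RingHom.map_det, RingHom.map_det, h,
    ← Polynomial.derivative_map, ← RingHom.map_adjugate, ← map_mul, RingHom.mapMatrix_apply,
    RingHom.mapMatrix_apply, Matrix.charpoly_map]

theorem aeval_diagonal {n R : Type*} [Fintype n] [DecidableEq n] [CommRing R] (d : n → R)
    (p : R[X]) : aeval (diagonal d) p = diagonal fun i => p.eval (d i) := by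
  have h : diagonal d = diagonalAlgHom R d := rfl
  rw [h, aeval_algHom_apply, diagonalAlgHom_apply]
  congr 1
  ext i
  rw [Polynomial.aeval_fn_apply]
  simp

/-- At `d i` the derivative of `∏ (X - d j)` is `∏_{j ≠ i} (d i - d j)`. -/
theorem pencilGenericity_diagonal_one_ne_zero {n K : Type*} [Fintype n] [DecidableEq n] [Field K]
    {d : n → K} (hd : Function.Injective d) : pencilGenericity (diagonal d) 1 ≠ 0 := by
  rw [pencilGenericity, det_one, one_mul, adjugate_one, mul_one, aeval_diagonal, det_diagonal,
    charpoly_diagonal, Finset.prod_ne_zero_iff]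
  intro i _
  rw [derivative_prod_finset, eval_finsetSum, Finset.sum_eq_single i]
  · simp only [eval_mul, eval_prod]
    refine mul_ne_zero (Finset.prod_ne_zero_iff.2 fun j hj => ?_) (by simp)
    rw [eval_sub, eval_X, eval_C, sub_ne_zero]
    exact hd.ne (Finset.ne_of_mem_erase hj).symm
  · intro j _ hj
    simp only [eval_mul, eval_prod]
    rw [Finset.prod_eq_zero (i := i)] <;> simp [hj.symm]
  · simp

/-- A common root of `χ` and `χ'` is an eigenvalue of `M`, so by spectral mapping `0` is an
eigenvalue of `χ'(M)`. -/
theorem separable_charpoly_of_det_ne_zero {n K : Type*} [Fintype n] [DecidableEq n] [Field K]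
    [IsAlgClosed K] (M : Matrix n n K) (h : (aeval M (derivative M.charpoly)).det ≠ 0) :
    M.charpoly.Separable := by
  rw [Polynomial.Separable, isCoprime_iff_aeval_ne_zero_of_isAlgClosed K K]
  intro a
  by_contra! hc
  simp only [coe_aeval_eq_eval] at hc
  have hM : a ∈ spectrum K M := mem_spectrum_iff_isRoot_charpoly.2 hc.1
  have h0 := spectrum.subset_polynomial_aeval M (derivative M.charpoly) ⟨a, hM, rfl⟩
  simp only [hc.2] at h0
  exact spectrum.zero_notMem K ((isUnit_iff_isUnit_det _).2 h.isUnit) h0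

theorem exists_injective_isRoot_of_separable {n K : Type*} [Fintype n] [Field K] [IsAlgClosed K]
    {p : K[X]} (hp : p.Separable) (hn : p.natDegree = Fintype.card n) :
    ∃ μ : n → K, Function.Injective μ ∧ ∀ i, p.IsRoot (μ i) := by
  classical
  have hc : Fintype.card n = Fintype.card p.roots.toFinset := by
    rw [Fintype.card_coe, Multiset.toFinset_card_of_nodup (nodup_roots hp), ← hn]
    exact (splits_iff_card_roots.1 (IsAlgClosed.splits p)).symm
  let e := Fintype.equivOfCardEq hc
  exact ⟨fun i => e i, Subtype.val_injective.comp e.injective, fun i =>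
    (mem_roots'.1 (Multiset.mem_toFinset.1 (e i).2)).2⟩

/-- Two symmetric matrices forming a generic pencil are simultaneously diagonal up to congruence. -/
theorem exists_simultaneous_congruence {n : Type*} [Fintype n] [DecidableEq n]
    {K : Type*} [Field K] [IsAlgClosed K] {A B : Matrix n n K}
    (hA : A.IsSymm) (hB : B.IsSymm) (h : pencilGenericity A B ≠ 0) :
    ∃ (Q : Matrix n n K) (μ : n → K), IsUnit Q.det ∧ Function.Injective μ ∧
      A = Q * diagonal μ * Qᵀ ∧ B = Q * Qᵀ := by
  obtain ⟨hdB, hdM⟩ := mul_ne_zero_iff.1 h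
  set M := A * B.adjugate with hM
  have hMT : Mᵀ = B.adjugate * A := by
    rw [hM, transpose_mul, adjugate_transpose, hA.eq, hB.eq]
  obtain ⟨μ, hμ, hroot⟩ := exists_injective_isRoot_of_separable (n := n)
    (separable_charpoly_of_det_ne_zero M hdM) (charpoly_natDegree_eq_dim M)
  -- Since `Mᵀ = adj(B) A`, these are the generalised eigenvectors `det B • A v = μ_i B v`.
  have hv : ∀ i, ∃ v : n → K, v ≠ 0 ∧ Mᵀ *ᵥ v = μ i • v := by
    intro i
    have h0 : (scalar n (μ i) - Mᵀ).det = 0 := by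
      rw [← eval_charpoly, charpoly_transpose]
      exact hroot i
    obtain ⟨v, hv, hv'⟩ := exists_mulVec_eq_zero_iff.2 h0
    refine ⟨v, hv, ?_⟩
    rw [sub_mulVec, sub_eq_zero] at hv'
    rw [← hv', scalar_apply, ← smul_one_eq_diagonal, smul_mulVec, one_mulVec]
  choose v hv0 hv using hv
  have hli : LinearIndependent K v :=
    Module.End.eigenvectors_linearIndependent' (toLin' Mᵀ) μ hμ v fun i =>
      Module.End.hasEigenvector_iff.2
        ⟨Module.End.mem_eigenspace_iff.2 (by rw [toLin'_apply, hv]), hv0 i⟩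
  let P : Matrix n n K := (of v)ᵀ
  have hP : IsUnit P.det := by
    rw [← isUnit_iff_isUnit_det, ← linearIndependent_cols_iff_isUnit]
    exact hli
  have hMP : Mᵀ * P = P * diagonal μ := by
    ext i j
    rw [mul_diagonal, mul_comm]
    exact congrFun (hv j) i
  have hAP : B.det • (A * P) = B * P * diagonal μ := by
    rw [Matrix.mul_assoc, ← hMP, hMT, ← Matrix.mul_assoc, ← Matrix.mul_assoc, mul_adjugate]
    simp
  -- The Gram matrix of the eigenvectors for `B`. As `C * diagonal μ` is a multiple of `Pᵀ A P`, it
  -- is symmetric; hence `C` commutes with a diagonal matrix with distinct entries and is itself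
  -- diagonal.
  set C := Pᵀ * B * P with hC
  have hCs : Cᵀ = C := by simp [hC, hB.eq, Matrix.mul_assoc]
  have hAC : B.det • (Pᵀ * A * P) = C * diagonal μ := by
    rw [Matrix.mul_assoc, ← Matrix.mul_smul, hAP]
    simp only [hC, Matrix.mul_assoc]
  have hcomm : C * diagonal μ = diagonal μ * C := by
    rw [← hAC]
    have := congrArg transpose hAC
    simpa [hA.eq, hCs, Matrix.mul_assoc] using this
  have hCd : C = diagonal fun i => C i i := by
    ext i j
    by_cases hij : i = j
    · subst hij; simp
    · rw [diagonal_apply_ne _ hij]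
      have := congrFun (congrFun hcomm i) j
      rw [mul_diagonal, diagonal_mul, mul_comm, ← sub_eq_zero, ← sub_mul] at this
      exact (mul_eq_zero.1 this).resolve_left (sub_ne_zero.2 (hμ.ne (Ne.symm hij)))
  have hCdet : IsUnit C.det := by
    rw [hC, det_mul, det_mul, det_transpose]
    exact (hP.mul hdB.isUnit).mul hP
  have hCi : ∀ i, C i i ≠ 0 := by
    rw [hCd, det_diagonal] at hCdet
    exact fun i => Finset.prod_ne_zero_iff.1 hCdet.ne_zero i (Finset.mem_univ i)
  -- Square roots of the diagonal of `C` rescale the eigenvectors so that `B` becomes the identity.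
  choose s hs using fun i => IsAlgClosed.exists_pow_nat_eq (C i i) two_pos
  have hs0 : ∀ i, s i ≠ 0 := fun i h0 => hCi i (by rw [← hs, h0]; simp)
  have hCs2 : C = diagonal s * diagonal s := by
    rw [diagonal_mul_diagonal]
    exact hCd.trans (congrArg diagonal (funext fun i => by rw [← sq, hs]))
  have hPT : IsUnit Pᵀ.det := by rwa [det_transpose]
  have back : ∀ X : Matrix n n K, Pᵀ⁻¹ * (Pᵀ * X * P) * P⁻¹ = X := by
    intro X
    rw [Matrix.mul_assoc Pᵀ, nonsing_inv_mul_cancel_left _ _ hPT, mul_nonsing_inv_cancel_right _ _ hP]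
  have hQT : (Pᵀ⁻¹ * diagonal s)ᵀ = diagonal s * P⁻¹ := by
    rw [transpose_mul, diagonal_transpose, transpose_nonsing_inv, transpose_transpose]
  -- The factor `B.det⁻¹` undoes the scaling introduced by the adjugate.
  refine ⟨Pᵀ⁻¹ * diagonal s, fun i => B.det⁻¹ * μ i, ?_, ?_, ?_, ?_⟩
  · rw [det_mul, det_diagonal]
    exact (isUnit_nonsing_inv_det _ hPT).mul
      (Finset.prod_ne_zero_iff.2 fun i _ => hs0 i).isUnit
  · exact fun i j hij => hμ (mul_left_cancel₀ (inv_ne_zero hdB) hij)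
  · have hA' : Pᵀ * A * P = diagonal s * diagonal (fun i => B.det⁻¹ * μ i) * diagonal s := by
      rw [← inv_smul_smul₀ hdB (Pᵀ * A * P), hAC, hCs2]
      simp only [diagonal_mul_diagonal, ← diagonal_smul]
      congr 1
      ext i
      simp only [Pi.smul_apply, smul_eq_mul]
      ring
    rw [← back A, hA', hQT]
    simp only [Matrix.mul_assoc]
  · rw [← back B, ← hC, hCs2, hQT]
    simp only [Matrix.mul_assoc]

end Matrices

/-! ### The Jordan–Kronecker form of a diagonal pencil -/

section NormalForm

variable {V : Type*} [AddCommGroup V] [Module ℂ V] {n : ℕ}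

/-- The symmetric form `e_i ⊗ e_j + e_j ⊗ e_i`. -/
noncomputable def symPair (e : Module.Basis (Fin n) ℂ V) (i j : Fin n) : SymForms V :=
  ⟨e i ⊗ₜ e j + e j ⊗ₜ e i, by
    change TensorProduct.comm ℂ V V _ = _
    simp [add_comm]⟩

theorem symPair_comm (e : Module.Basis (Fin n) ℂ V) (i j : Fin n) :
    symPair e i j = symPair e j i :=
  Subtype.ext (add_comm _ _)

theorem tensorMatrix_symPair (e : Module.Basis (Fin n) ℂ V) (i j k l : Fin n) :
    tensorMatrix e (symPair e i j : V ⊗[ℂ] V) k l =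
      (if i = k ∧ j = l then 1 else 0) + if j = k ∧ i = l then 1 else 0 := by
  simp [tensorMatrix, symPair, Finsupp.single_apply, ← ite_and, and_comm]

/-- The symmetric form `∑ d_i e_i ⊗ e_i`. -/
noncomputable def diagForm (e : Module.Basis (Fin n) ℂ V) (d : Fin n → ℂ) : SymForms V :=
  ∑ i, (d i / 2) • symPair e i i

theorem coe_diagForm (e : Module.Basis (Fin n) ℂ V) (d : Fin n → ℂ) :
    (diagForm e d : V ⊗[ℂ] V) = ∑ i, d i • (e i ⊗ₜ[ℂ] e i) := by
  simp only [diagForm, AddSubmonoidClass.coe_finsetSum, Submodule.coe_smul, symPair,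
    ← two_smul ℂ (e _ ⊗ₜ[ℂ] e _), smul_smul]
  simp

theorem tensorMatrix_diagForm (e : Module.Basis (Fin n) ℂ V) (d : Fin n → ℂ) :
    tensorMatrix e (diagForm e d : V ⊗[ℂ] V) = Matrix.diagonal d := by
  ext i j
  rw [coe_diagForm]
  simp only [tensorMatrix, Matrix.of_apply, map_sum, map_smul, Finsupp.coe_finsetSum,
    Finset.sum_apply, Finsupp.smul_apply, Module.Basis.tensorProduct_repr_tmul_apply,
    Module.Basis.repr_self, Finsupp.single_apply, Matrix.diagonal_apply]
  rw [Finset.sum_eq_single i] <;> aesop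

/-- The operator `e_j ↦ e_i`, killing the other basis vectors. -/
noncomputable def elemOp (e : Module.Basis (Fin n) ℂ V) (i j : Fin n) : Module.End ℂ V :=
  (e.coord j).smulRight (e i)

theorem elemOp_apply (e : Module.Basis (Fin n) ℂ V) (i j k : Fin n) :
    elemOp e i j (e k) = if k = j then e i else 0 := by
  simp [elemOp, Finsupp.single_apply]

/-- Only the summand `d_j e_j ⊗ e_j` survives, and `X ⊗ 1 + 1 ⊗ X` replaces one factor `e_j` at a
time by `e_i`. For `i = j` this is consistent with `symPair e i i = 2 e_i ⊗ e_i`. -/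
theorem orbitMap_elemOp (e : Module.Basis (Fin n) ℂ V) (d : Fin n → ℂ) (i j : Fin n) :
    orbitMap (congruenceRep V) (diagForm e d) (elemOp e i j) = d j • symPair e i j := by
  apply Subtype.ext
  change congruenceOp (elemOp e i j) (diagForm e d : V ⊗[ℂ] V) = _
  rw [coe_diagForm, map_sum, Finset.sum_eq_single j]
  · simp [congruenceOp, elemOp_apply, symPair]
  · intro k _ hk
    simp [congruenceOp, elemOp_apply, hk]
  · simp

/-- The index set of the blocks: the diagonal positions and the positions above the diagonal. -/
abbrev BlockIndex (n : ℕ) : Type := Fin n ⊕ {p : Fin n × Fin n // p.1 < p.2}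

/-- The blocks of the pencil of two diagonal forms: a Jordan block for each diagonal position and a
horizontal block of width two for each position above the diagonal. -/
def diagBlocks (μ : Fin n → ℂ) : BlockIndex n → JKBlock
  | .inl i => .jordan (μ i) 1
  | .inr _ => .horizontal 2

/-- The columns of the blocks `diagBlocks μ`. -/
noncomputable def colVec (e : Module.Basis (Fin n) ℂ V) (μ : Fin n → ℂ) :
    (Σ i, Fin (diagBlocks μ i).cols) → Module.End ℂ V
  | ⟨.inl i, _⟩ => elemOp e i i
  -- The coefficients are chosen so that `(R_a, R_b)` takes the values `(0, s)` at column 0 and `(s,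
  -- 0)` at column 1, where `s` is the `symPair` of `p`.
  | ⟨.inr p, c⟩ => (μ p.1.2 - μ p.1.1)⁻¹ •
      if (c : ℕ) = 0 then μ p.1.2 • elemOp e p.1.2 p.1.1 - μ p.1.1 • elemOp e p.1.1 p.1.2
      else elemOp e p.1.1 p.1.2 - elemOp e p.1.2 p.1.1

/-! ### A basis of `gl(V)` adapted to the blocks. -/

theorem card_offDiag_lt (n : ℕ) :
    Fintype.card {p : Fin n × Fin n // p.1 < p.2} = n * (n - 1) / 2 := by
  have h : ∀ j : Fin n, ∑ i : Fin n, (if i < j then 1 else 0) = (j : ℕ) := by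
    intro j
    rw [← Finset.card_filter, Finset.filter_gt_eq_Iio, Fin.card_Iio]
  rw [Fintype.card_subtype, Finset.card_filter, Fintype.sum_prod_type_right]
  simp only [h]
  rw [Fin.sum_univ_eq_sum_range (fun i => i), Finset.sum_range_id]

theorem elemOp_mem_span_colVec (e : Module.Basis (Fin n) ℂ V) {μ : Fin n → ℂ}
    (hμ : Function.Injective μ) (i j : Fin n) :
    elemOp e i j ∈ Submodule.span ℂ (Set.range (colVec e μ)) := by
  have key : ∀ p : {p : Fin n × Fin n // p.1 < p.2},
      elemOp e p.1.1 p.1.2 ∈ Submodule.span ℂ (Set.range (colVec e μ)) ∧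
      elemOp e p.1.2 p.1.1 ∈ Submodule.span ℂ (Set.range (colVec e μ)) := by
    intro p
    have hp : μ p.1.2 - μ p.1.1 ≠ 0 := sub_ne_zero.2 (hμ.ne p.2.ne')
    have h0 : colVec e μ ⟨.inr p, (0 : Fin 2)⟩ ∈ Submodule.span ℂ (Set.range (colVec e μ)) :=
      Submodule.subset_span ⟨_, rfl⟩
    have h1 : colVec e μ ⟨.inr p, (1 : Fin 2)⟩ ∈ Submodule.span ℂ (Set.range (colVec e μ)) :=
      Submodule.subset_span ⟨_, rfl⟩
    -- For `p = (i, j)` with columns `v₀, v₁`, inverting the change of basis gives `E_ij = v₀ + μ_j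
    -- v₁` and `E_ji = v₀ + μ_i v₁`.
    constructor
    · convert add_mem h0 (Submodule.smul_mem _ (μ p.1.2) h1) using 1
      rw [← sub_eq_zero, ← smul_right_injective _ hp |>.eq_iff]
      simp only [colVec, Fin.val_zero, Fin.val_one, if_true, one_ne_zero, if_false, smul_sub,
        smul_add, smul_smul, smul_zero]
      match_scalars <;> field_simp <;> ring
    · convert add_mem h0 (Submodule.smul_mem _ (μ p.1.1) h1) using 1
      rw [← sub_eq_zero, ← smul_right_injective _ hp |>.eq_iff]
      simp only [colVec, Fin.val_zero, Fin.val_one, if_true, one_ne_zero, if_false, smul_sub,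
        smul_add, smul_smul, smul_zero]
      match_scalars <;> field_simp <;> ring
  rcases lt_trichotomy i j with h | rfl | h
  · exact (key ⟨(i, j), h⟩).1
  · exact Submodule.subset_span ⟨⟨.inl i, (0 : Fin 1)⟩, rfl⟩
  · exact (key ⟨(j, i), h⟩).2

theorem span_colVec (e : Module.Basis (Fin n) ℂ V) {μ : Fin n → ℂ} (hμ : Function.Injective μ) :
    ⊤ ≤ Submodule.span ℂ (Set.range (colVec e μ)) := by
  intro X _
  have hX : X = ∑ j, ∑ i, e.repr (X (e j)) i • elemOp e i j := by
    refine e.ext fun k => ?_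
    simp [LinearMap.sum_apply, elemOp_apply, e.sum_repr]
  rw [hX]
  exact sum_mem fun j _ => sum_mem fun i _ =>
    Submodule.smul_mem _ _ (elemOp_mem_span_colVec e hμ i j)

/-- One column per diagonal position and two per pair make up `dim gl(V)`, so spanning suffices for
`colBasis`. -/
theorem sum_card_pairs (n : ℕ) : n + n * (n - 1) / 2 * 2 = n * n := by
  rw [Nat.div_mul_cancel (Nat.even_mul_pred_self n).two_dvd]
  cases n <;> simp; ring

/-- The basis of `gl(V)` formed by `colVec`. -/
noncomputable def colBasis (e : Module.Basis (Fin n) ℂ V) {μ : Fin n → ℂ}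
    (hμ : Function.Injective μ) :
    Module.Basis (Σ i, Fin (diagBlocks μ i).cols) ℂ (Module.End ℂ V) :=
  basisOfTopLeSpanOfCardEqFinrank (colVec e μ) (span_colVec e hμ) <| by
    have : Module.Finite ℂ V := .of_basis e
    have : Module.Free ℂ V := .of_basis e
    rw [Module.finrank_linearMap, Module.finrank_eq_card_basis e, Fintype.card_fin,
      Fintype.card_sigma, Fintype.sum_sum_type]
    simp only [Fintype.card_fin]
    change ∑ _i : Fin n, 1 + ∑ _p : {p : Fin n × Fin n // p.1 < p.2}, 2 = n * n
    rw [Finset.sum_const, Finset.sum_const, Finset.card_univ, Finset.card_univ, card_offDiag_lt,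
      Fintype.card_fin, smul_eq_mul, smul_eq_mul, mul_one, sum_card_pairs]

theorem colBasis_apply (e : Module.Basis (Fin n) ℂ V) {μ : Fin n → ℂ}
    (hμ : Function.Injective μ) (x) : colBasis e hμ x = colVec e μ x := by
  simp [colBasis]

/-! ### A basis of `S²(V)` adapted to the blocks. -/

theorem symForms_ext (e : Module.Basis (Fin n) ℂ V) {Q Q' : SymForms V}
    (h : ∀ k l, k ≤ l → tensorMatrix e (Q : V ⊗[ℂ] V) k l = tensorMatrix e (Q' : V ⊗[ℂ] V) k l) :
    Q = Q' := by
  apply Subtype.ext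
  apply (e.tensorProduct e).repr.injective
  ext ⟨k, l⟩
  rcases le_total k l with hkl | hkl
  · exact h k l hkl
  · have h1 := ((mem_symForms_iff e _).1 Q.2).apply k l
    have h2 := ((mem_symForms_iff e _).1 Q'.2).apply k l
    exact h1.symm.trans ((h l k hkl).trans h2)

/-- The vectors `e_i ⊗ e_j + e_j ⊗ e_i`, `i ≤ j`. -/
noncomputable def rowVec (e : Module.Basis (Fin n) ℂ V) : BlockIndex n → SymForms V
  | .inl i => symPair e i i
  | .inr p => symPair e p.1.1 p.1.2

/-- On and above the diagonal each entry sees exactly one basis vector, with weight 2 on the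
diagonal. Both independence and spanning in `symBasis` follow by reading off coefficients. -/
theorem tensorMatrix_sum_rowVec (e : Module.Basis (Fin n) ℂ V) (c : BlockIndex n → ℂ)
    {k l : Fin n} (hkl : k ≤ l) :
    tensorMatrix e ((∑ r, c r • rowVec e r : SymForms V) : V ⊗[ℂ] V) k l =
      if h : k < l then c (.inr ⟨(k, l), h⟩) else 2 * c (.inl k) := by
  have hlin : tensorMatrix e ((∑ r, c r • rowVec e r : SymForms V) : V ⊗[ℂ] V) k l =
      ∑ r, c r * tensorMatrix e (rowVec e r : V ⊗[ℂ] V) k l := by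
    simp [tensorMatrix, AddSubmonoidClass.coe_finsetSum]
  rw [hlin, Fintype.sum_sum_type]
  simp only [rowVec, tensorMatrix_symPair]
  split_ifs with h
  · rw [Finset.sum_eq_zero, Finset.sum_eq_single ⟨(k, l), h⟩, zero_add]
    · simp [h.ne']
    · rintro ⟨⟨i, j⟩, hij⟩ - hne
      have h1 : ¬(i = k ∧ j = l) := fun ⟨h1, h2⟩ => hne (by subst h1 h2; rfl)
      have h2 : ¬(j = k ∧ i = l) := fun ⟨h1, h2⟩ => by
        subst h1 h2; exact lt_asymm hij h
      simp [h1, h2]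
    · simp
    · intro i _
      have h1 : ¬(i = k ∧ i = l) := fun ⟨h1, h2⟩ => h.ne (h1.symm.trans h2)
      simp [h1]
  · obtain rfl : k = l := le_antisymm hkl (not_lt.1 h)
    rw [Finset.sum_eq_single k, Finset.sum_eq_zero, add_zero]
    · simp; ring
    · rintro ⟨⟨i, j⟩, hij⟩ -
      have h1 : ¬(i = k ∧ j = k) := fun ⟨h1, h2⟩ => hij.ne (h1.trans h2.symm)
      have h2 : ¬(j = k ∧ i = k) := fun h => h1 h.symm
      simp [h1, h2]
    · intro i _ hi
      simp [hi]
    · simp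

/-- The basis of `S²(V)` formed by the vectors `e_i ⊗ e_j + e_j ⊗ e_i`, `i ≤ j`. -/
noncomputable def symBasis (e : Module.Basis (Fin n) ℂ V) :
    Module.Basis (BlockIndex n) ℂ (SymForms V) :=
  Module.Basis.mk (v := rowVec e)
    (Fintype.linearIndependent_iff.2 fun c hc => by
      have h : ∀ k l : Fin n, k ≤ l →
          (if h : k < l then c (.inr ⟨(k, l), h⟩) else 2 * c (.inl k)) = 0 := by
        intro k l hkl
        rw [← tensorMatrix_sum_rowVec e c hkl, hc]
        simp [tensorMatrix]
      rintro (i | ⟨⟨i, j⟩, hij⟩)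
      · simpa using h i i le_rfl
      · have hij' : i < j := hij
        simpa [hij'] using h i j hij'.le)
    (fun Q _ => by
      have hQ : Q = ∑ r, (Sum.elim (fun i => tensorMatrix e (Q : V ⊗[ℂ] V) i i / 2)
          (fun p => tensorMatrix e (Q : V ⊗[ℂ] V) p.1.1 p.1.2) r : ℂ) • rowVec e r := by
        apply symForms_ext e
        intro k l hkl
        rw [tensorMatrix_sum_rowVec e _ hkl]
        split_ifs with h
        · rfl
        · obtain rfl : k = l := le_antisymm hkl (not_lt.1 h)
          simp only [Sum.elim_inl]
          ring
      rw [hQ]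
      exact sum_mem fun r _ => Submodule.smul_mem _ _ (Submodule.subset_span ⟨r, rfl⟩))

/-- Every block is `1 × 1` or `1 × 2`, so rows correspond to blocks. -/
instance (μ : Fin n → ℂ) (i : BlockIndex n) : Unique (Fin (diagBlocks μ i).rows) :=
  match i with
  | .inl _ => inferInstanceAs (Unique (Fin 1))
  | .inr _ => inferInstanceAs (Unique (Fin 1))

/-- The basis `symBasis`, indexed by the rows of the blocks `diagBlocks μ`. -/
noncomputable def rowBasis (e : Module.Basis (Fin n) ℂ V) (μ : Fin n → ℂ) :
    Module.Basis (Σ i, Fin (diagBlocks μ i).rows) ℂ (SymForms V) :=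
  (symBasis e).reindex (Equiv.sigmaUnique _ _).symm

theorem rowBasis_repr_rowVec (e : Module.Basis (Fin n) ℂ V) (μ : Fin n → ℂ) (i : BlockIndex n)
    (r : Σ i, Fin (diagBlocks μ i).rows) :
    (rowBasis e μ).repr (rowVec e i) r = if i = r.1 then 1 else 0 := by
  have : rowVec e i = symBasis e i := by simp [symBasis]
  rw [this]
  obtain ⟨j, y⟩ := r
  by_cases h : i = j
  · subst h
    simp [rowBasis, Subsingleton.elim default y]
  · simp [rowBasis, h]

/-! ### The matrices of `R_a` and `R_b` in these bases. -/

theorem orbitMap_colVec_diagForm (e : Module.Basis (Fin n) ℂ V) {μ : Fin n → ℂ}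
    (hμ : Function.Injective μ) (x : Σ i, Fin (diagBlocks μ i).cols) :
    orbitMap (congruenceRep V) (diagForm e μ) (colVec e μ x) =
      (match x with
        | ⟨.inl i, _⟩ => μ i
        | ⟨.inr _, c⟩ => if (c : ℕ) = 0 then 0 else 1) • rowVec e x.1 := by
  rcases x with ⟨i | p, c⟩
  · simp only [colVec, orbitMap_elemOp, rowVec]
  · have hp : μ p.1.2 - μ p.1.1 ≠ 0 := sub_ne_zero.2 (hμ.ne p.2.ne')
    simp only [colVec, rowVec]
    split_ifs with h
    · simp only [map_smul, map_sub, orbitMap_elemOp, symPair_comm e p.1.2 p.1.1]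
      module
    · simp only [map_smul, map_sub, orbitMap_elemOp, symPair_comm e p.1.2 p.1.1]
      match_scalars
      field_simp

theorem orbitMap_colVec_diagForm_one (e : Module.Basis (Fin n) ℂ V) {μ : Fin n → ℂ}
    (hμ : Function.Injective μ) (x : Σ i, Fin (diagBlocks μ i).cols) :
    orbitMap (congruenceRep V) (diagForm e 1) (colVec e μ x) =
      (match x with
        | ⟨.inl _, _⟩ => (1 : ℂ)
        | ⟨.inr _, c⟩ => if (c : ℕ) = 0 then 1 else 0) • rowVec e x.1 := by
  rcases x with ⟨i | p, c⟩
  · simp only [colVec, orbitMap_elemOp, rowVec, Pi.one_apply]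
  · have hp : μ p.1.2 - μ p.1.1 ≠ 0 := sub_ne_zero.2 (hμ.ne p.2.ne')
    simp only [colVec, rowVec]
    split_ifs with h
    · simp only [map_smul, map_sub, orbitMap_elemOp, symPair_comm e p.1.2 p.1.1, Pi.one_apply, one_smul]
      match_scalars
      field_simp
    · simp only [map_smul, map_sub, orbitMap_elemOp, symPair_comm e p.1.2 p.1.1, Pi.one_apply]
      module

/-- This and the next three unfold the index types, so that entries at explicit numerals can be
evaluated. -/
theorem JKBlock.matA_jordan (μ : ℂ) (k : ℕ+) (i j : Fin k) :
    (JKBlock.jordan μ k).matA i j =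
      if (j : ℕ) = i then μ else if (j : ℕ) = i + 1 then 1 else 0 := rfl

theorem JKBlock.matB_jordan (μ : ℂ) (k : ℕ+) (i j : Fin k) :
    (JKBlock.jordan μ k).matB i j = if (j : ℕ) = i then 1 else 0 := rfl

theorem JKBlock.matA_horizontal (h : ℕ+) (i : Fin (h - 1)) (j : Fin h) :
    (JKBlock.horizontal h).matA i j = if (j : ℕ) = i + 1 then 1 else 0 := rfl

theorem JKBlock.matB_horizontal (h : ℕ+) (i : Fin (h - 1)) (j : Fin h) :
    (JKBlock.horizontal h).matB i j = if (j : ℕ) = i then 1 else 0 := rfl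

theorem hasJKNormalForm_diagForm (e : Module.Basis (Fin n) ℂ V) {μ : Fin n → ℂ}
    (hμ : Function.Injective μ) :
    HasJKNormalForm (orbitMap (congruenceRep V) (diagForm e μ))
      (orbitMap (congruenceRep V) (diagForm e 1)) (diagBlocks μ) := by
  refine ⟨colBasis e hμ, rowBasis e μ, ?_, ?_⟩
  · ext ⟨i, r⟩ ⟨j, x⟩
    rw [LinearMap.toMatrix_apply, colBasis_apply, orbitMap_colVec_diagForm e hμ, map_smul,
      Finsupp.smul_apply, rowBasis_repr_rowVec]
    by_cases h : i = j
    · subst h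
      rw [Matrix.blockDiagonal'_apply_eq]
      rcases i with i | p
      · change Fin 1 at r x
        have hr := Subsingleton.elim r 0
        have hx := Subsingleton.elim x 0
        subst hr hx
        rw [show (diagBlocks μ (.inl i)).matA (0 : Fin 1) (0 : Fin 1) = μ i from
          (JKBlock.matA_jordan (μ i) 1 (0 : Fin 1) (0 : Fin 1)).trans (if_pos rfl)]
        simp
      · change Fin 1 at r
        change Fin 2 at x
        have hr := Subsingleton.elim r 0
        subst hr
        fin_cases x
        · change _ = (diagBlocks μ (.inr p)).matA (0 : Fin 1) (0 : Fin 2)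
          rw [show (diagBlocks μ (.inr p)).matA (0 : Fin 1) (0 : Fin 2) = 0 from
            (JKBlock.matA_horizontal 2 (0 : Fin 1) (0 : Fin 2)).trans (if_neg zero_ne_one)]
          simp
        · change _ = (diagBlocks μ (.inr p)).matA (0 : Fin 1) (1 : Fin 2)
          rw [show (diagBlocks μ (.inr p)).matA (0 : Fin 1) (1 : Fin 2) = 1 from
            (JKBlock.matA_horizontal 2 (0 : Fin 1) (1 : Fin 2)).trans (if_pos rfl)]
          simp
    · rw [Matrix.blockDiagonal'_apply_ne _ _ _ h]
      simp [Ne.symm h]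
  · ext ⟨i, r⟩ ⟨j, x⟩
    rw [LinearMap.toMatrix_apply, colBasis_apply, orbitMap_colVec_diagForm_one e hμ, map_smul,
      Finsupp.smul_apply, rowBasis_repr_rowVec]
    by_cases h : i = j
    · subst h
      rw [Matrix.blockDiagonal'_apply_eq]
      rcases i with i | p
      · change Fin 1 at r x
        have hr := Subsingleton.elim r 0
        have hx := Subsingleton.elim x 0
        subst hr hx
        rw [show (diagBlocks μ (.inl i)).matB (0 : Fin 1) (0 : Fin 1) = 1 from
          (JKBlock.matB_jordan (μ i) 1 (0 : Fin 1) (0 : Fin 1)).trans (if_pos rfl)]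
        simp
      · change Fin 1 at r
        change Fin 2 at x
        have hr := Subsingleton.elim r 0
        subst hr
        fin_cases x
        · change _ = (diagBlocks μ (.inr p)).matB (0 : Fin 1) (0 : Fin 2)
          rw [show (diagBlocks μ (.inr p)).matB (0 : Fin 1) (0 : Fin 2) = 1 from
            (JKBlock.matB_horizontal 2 (0 : Fin 1) (0 : Fin 2)).trans (if_pos rfl)]
          simp
        · change _ = (diagBlocks μ (.inr p)).matB (0 : Fin 1) (1 : Fin 2)
          rw [show (diagBlocks μ (.inr p)).matB (0 : Fin 1) (1 : Fin 2) = 0 from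
            (JKBlock.matB_horizontal 2 (0 : Fin 1) (1 : Fin 2)).trans (if_neg one_ne_zero)]
          simp
    · rw [Matrix.blockDiagonal'_apply_ne _ _ _ h]
      simp [Ne.symm h]

/-- Injectivity of `μ` makes the list of eigenvalues duplicate-free and leaves a single block, of
size 1, over each. -/
theorem algebraicType_diagBlocks {μ : Fin n → ℂ} (hμ : Function.Injective μ) :
    AlgebraicType.ofBlocks (Finset.univ.val.map (diagBlocks μ)) =
      { jordan := Multiset.replicate n {1}
        horizontal := Multiset.replicate (n * (n - 1) / 2) 2
        vertical := 0 } := by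
  classical
  have huniv : (Finset.univ : Finset (BlockIndex n)).val.map (diagBlocks μ) =
      (Finset.univ : Finset (Fin n)).val.map (fun i => JKBlock.jordan (μ i) 1) +
        Multiset.replicate (n * (n - 1) / 2) (JKBlock.horizontal 2) := by
    rw [← card_offDiag_lt, ← Finset.card_univ, Finset.card_def, ← Multiset.map_const']
    rw [← Finset.univ_disjSum_univ, Finset.val_disjSum, Multiset.disjSum, Multiset.map_add,
      Multiset.map_map, Multiset.map_map]
    rfl
  have hrep : ∀ {β : Type} (f : JKBlock → Option β) (m : ℕ) (b : JKBlock),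
      (Multiset.replicate m b).filterMap f = (f b).elim 0 (Multiset.replicate m) := by
    intro β f m b
    induction m with
    | zero => cases f b <;> simp
    | succ m ih => cases h : f b <;> simp_all [Multiset.replicate_succ]
  have hnone : ∀ {β : Type} (s : Multiset (Fin n)),
      s.filterMap (fun _ => (none : Option β)) = 0 := by
    intro β s
    induction s using Multiset.induction_on <;> simp_all
  have hj : (Finset.univ.val.map (diagBlocks μ)).filterMap JKBlock.jordanData =
      (Finset.univ : Finset (Fin n)).val.map fun i => ((μ i : OnePoint ℂ), (1 : ℕ+)) := by
    rw [huniv, Multiset.filterMap_add, hrep, Multiset.filterMap_map]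
    exact (add_zero _).trans (congrFun (Multiset.filterMap_eq_map _) _)
  have hμ' : Function.Injective fun i => (μ i : OnePoint ℂ) := OnePoint.coe_injective.comp hμ
  ext1
  · simp only [AlgebraicType.ofBlocks, hj, Multiset.map_map, Multiset.filter_map]
    rw [Multiset.Nodup.dedup, Multiset.map_map,
      Multiset.map_congr rfl (g := fun _ => {1}), Multiset.map_const', Finset.card_val,
      Finset.card_univ, Fintype.card_fin]
    swap
    · exact Finset.univ.nodup.map hμ'
    intro i _
    have hf : (Finset.univ : Finset (Fin n)).val.filter
        (fun j => (μ j : OnePoint ℂ) = μ i) = {i} := by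
      rw [← Finset.singleton_val, ← Finset.filter_val]
      congr 1
      ext j
      simp [hμ.eq_iff]
    simp only [Function.comp_apply]
    rw [hf]
    simp
  · simp only [AlgebraicType.ofBlocks]
    rw [huniv, Multiset.filterMap_add, hrep, Multiset.filterMap_map]
    exact (congrArg (· + _) (hnone _)).trans (zero_add _)
  · simp only [AlgebraicType.ofBlocks]
    rw [huniv, Multiset.filterMap_add, hrep, Multiset.filterMap_map]
    exact (add_zero _).trans (hnone _)

end NormalForm

/-! ### Genericity -/

section Generic

variable {V : Type*} [AddCommGroup V] [Module ℂ V] {n : ℕ}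

theorem tensorMatrix_injective {ι : Type*} (b : Module.Basis ι ℂ V) :
    Function.Injective (tensorMatrix b) := fun Q Q' h => by
  apply (b.tensorProduct b).repr.injective
  ext ⟨i, j⟩
  exact congrFun (congrFun h i) j

/-- The right-hand side is the matrix of the image of `diagForm e d` under `g ⊗ g`, which carries
`e_i ⊗ e_i` to `g e_i ⊗ g e_i`. A congruence thus becomes a change of basis. -/
theorem eq_diagForm_of_tensorMatrix_eq (e : Module.Basis (Fin n) ℂ V) (g : V ≃ₗ[ℂ] V)
    (d : Fin n → ℂ) {a : SymForms V}
    (h : tensorMatrix e (a : V ⊗[ℂ] V) = LinearMap.toMatrix e e g * Matrix.diagonal d *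
      (LinearMap.toMatrix e e g).transpose) : a = diagForm (e.map g) d := by
  rw [← tensorMatrix_diagForm e d, ← tensorMatrix_map] at h
  apply Subtype.ext
  rw [tensorMatrix_injective e h, coe_diagForm, coe_diagForm]
  simp

theorem exists_basis_eq_diagForm (e : Module.Basis (Fin n) ℂ V) (a b : SymForms V)
    (h : pencilGenericity (tensorMatrix e (a : V ⊗[ℂ] V)) (tensorMatrix e (b : V ⊗[ℂ] V)) ≠ 0) :
    ∃ (e' : Module.Basis (Fin n) ℂ V) (μ : Fin n → ℂ), Function.Injective μ ∧
      a = diagForm e' μ ∧ b = diagForm e' 1 := by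
  obtain ⟨Q, μ, hQ, hμ, ha, hb⟩ := exists_simultaneous_congruence
    ((mem_symForms_iff e _).1 a.2) ((mem_symForms_iff e _).1 b.2) h
  let g : V ≃ₗ[ℂ] V := Matrix.toLinearEquiv e Q hQ
  have hg : LinearMap.toMatrix e e g = Q := LinearMap.toMatrix_toLin e e Q
  refine ⟨e.map g, μ, hμ, eq_diagForm_of_tensorMatrix_eq e g μ (by rw [hg, ha]),
    eq_diagForm_of_tensorMatrix_eq e g 1 ?_⟩
  rw [hg, hb]
  have : Matrix.diagonal (1 : Fin n → ℂ) = 1 := Matrix.diagonal_one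
  rw [this, mul_one]

/-- The matrix of linear forms whose value at `x` is the matrix of the symmetric form `f x`. -/
noncomputable def genericTensorMatrix {E κ : Type*} [AddCommGroup E] [Module ℂ E] [Fintype κ]
    (c : Module.Basis κ ℂ E) (e : Module.Basis (Fin n) ℂ V) (f : E →ₗ[ℂ] V ⊗[ℂ] V) :
    Matrix (Fin n) (Fin n) (MvPolynomial κ ℂ) :=
  Matrix.of fun i j => ∑ k, MvPolynomial.C (tensorMatrix e (f (c k)) i j) * MvPolynomial.X k

theorem eval_genericTensorMatrix {E κ : Type*} [AddCommGroup E] [Module ℂ E] [Fintype κ]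
    (c : Module.Basis κ ℂ E) (e : Module.Basis (Fin n) ℂ V) (f : E →ₗ[ℂ] V ⊗[ℂ] V) (x : E) :
    (MvPolynomial.eval fun k => c.repr x k).mapMatrix (genericTensorMatrix c e f) =
      tensorMatrix e (f x) := by
  ext i j
  conv_rhs => rw [← c.sum_repr x]
  simp only [genericTensorMatrix, tensorMatrix, RingHom.mapMatrix_apply, Matrix.map_apply,
    Matrix.of_apply, map_sum, map_mul, MvPolynomial.eval_C, MvPolynomial.eval_X, map_smul,
    Finsupp.coe_finsetSum, Finset.sum_apply, Finsupp.smul_apply, smul_eq_mul, mul_comm]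

end Generic

theorem mainTheorem7 {V : Type*} [AddCommGroup V] [Module ℂ V] [FiniteDimensional ℂ V] (n : ℕ)
    (hn : Module.finrank ℂ V = n) :
    HasJKInvariants (congruenceRep V)
      { jordan := Multiset.replicate n {1}
        horizontal := Multiset.replicate (n * (n - 1) / 2) 2
        vertical := 0 } := by
  let e : Module.Basis (Fin n) ℂ V := Module.finBasisOfFinrankEq ℂ V hn
  let c := Module.finBasis ℂ (SymForms V × SymForms V)
  let f₁ := (SymForms V).subtype ∘ₗ LinearMap.fst ℂ (SymForms V) (SymForms V)
  let f₂ := (SymForms V).subtype ∘ₗ LinearMap.snd ℂ (SymForms V) (SymForms V)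
  let p := pencilGenericity (genericTensorMatrix c e f₁) (genericTensorMatrix c e f₂)
  have hp : ∀ x, MvPolynomial.eval (fun k => c.repr x k) p =
      pencilGenericity (tensorMatrix e (x.1 : V ⊗[ℂ] V)) (tensorMatrix e (x.2 : V ⊗[ℂ] V)) := by
    intro x
    rw [map_pencilGenericity, eval_genericTensorMatrix, eval_genericTensorMatrix]
    rfl
  refine ⟨c, p, fun h0 => ?_, fun x hx => ?_⟩
  -- The polynomial is nonzero at the pair `diag(0, …, n - 1)` and the identity.
  · have h := hp (diagForm e fun i => (i : ℂ), diagForm e 1)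
    rw [h0, map_zero, tensorMatrix_diagForm, tensorMatrix_diagForm] at h
    exact pencilGenericity_diagonal_one_ne_zero
      (fun i j hij => Fin.ext (Nat.cast_injective hij)) h.symm
  · rw [hp] at hx
    obtain ⟨e', μ, hμ, ha, hb⟩ := exists_basis_eq_diagForm e _ _ hx
    rw [ha, hb]
    exact ⟨_, _, _, _, hasJKNormalForm_diagForm e' hμ, algebraicType_diagBlocks hμ⟩
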